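/- For permutations $S$ of length $m$ and $P$ of length $n$ let $\#(S,P)$ be the number of $m$-element sets of positions $i_1<\dots<i_m$ in $\{1,\dots,n\}$ such that $P(i_1)\cdots P(i_m)$ is order-isomorphic to $S$, let $p(S,P)=\#(S,P)/\binom{n}{m}$ (with $p(S,P)=0$ if $n<m$), and let $p(S,n)$ be the maximum of $p(S,P)$ over all permutations $P$ of length $n$. Theorem. For $S=1324$ the limit $$p(1324)=\lim_{n\to\infty}p(1324,n),$$ called the packing density of $1324$, exists and satisfies $$0.244054321 < p(1324) < 0.244054549.$$ Moreover, the sharper upper bound $p(1324) < 0.244054540$ holds. -/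

import Mathlib

namespace PatternPacking

/-- The number of occurrences of the permutation `S` of length `m` as a subpermutation of the
permutation `P` of length `n`. Sets of `m` positions are given by their increasing enumerations
`e : Fin m ↪o Fin n`. -/
noncomputable def occurrences {m n : ℕ} (S : Equiv.Perm (Fin m)) (P : Equiv.Perm (Fin n)) : ℕ :=
  Nat.card {e : Fin m ↪o Fin n // ∀ i j : Fin m, S i < S j ↔ P (e i) < P (e j)}

/-- The density of `S` in `P`: the number of occurrences divided by the number of `m`-sets of
positions. If `n < m`, the binomial coefficient vanishes and the density is `0`. -/
noncomputable def density {m n : ℕ} (S : Equiv.Perm (Fin m)) (P : Equiv.Perm (Fin n)) : ℝ :=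
  (occurrences S P : ℝ) / (n.choose m : ℝ)

/-- The maximum density of `S` over all permutations of length `n`. -/
noncomputable def maxDensity {m : ℕ} (S : Equiv.Perm (Fin m)) (n : ℕ) : ℝ :=
  Finset.univ.sup' Finset.univ_nonempty (fun P : Equiv.Perm (Fin n) => density S P)

/-- The packing density of `S`: the limit of the maximum densities as the length tends to
infinity. -/
noncomputable def packingDensity {m : ℕ} (S : Equiv.Perm (Fin m)) : ℝ :=
  Filter.limUnder Filter.atTop (fun n : ℕ => maxDensity S n)

/-- The permutation 1324, with positions and values counted from `0`. -/
def perm1324 : Equiv.Perm (Fin 4) := Equiv.swap 1 2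

theorem perm1324_apply : (perm1324 : Fin 4 → Fin 4) = ![0, 2, 1, 3] := by
  decide

end PatternPacking

/-! Upper bound. Order the points of a permutation by position and value together. An occurrence of
1324 is then a diamond: a below b and c, both below d, with b and c incomparable. It is counted
twice, and allowing b = c only adds to the count. Give the points weights of total mass 1. Shifting
weight between two incomparable points changes the weighted count by a convex quadratic
(`diamondSum_add_mul`), so one of them can be emptied without decreasing it. Hence the support may
be taken to be a chain (`diamondSum_le`). On a chain only b = c survives, and the points become
consecutive layers of [0, 1], a layer [a, b] contributing 12 (b - a)² a (1 - b).

Each contribution is at most the increment of `fullPotential` over the layer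
(`layer_le_fullPotential_sub`), so the sum telescopes to 0.24405453999. The potential is an explicit
polynomial supersolution of the underlying dynamic program. Its inequalities are reduced to one
variable and certified by exact integer bisection.

Lower bound. Thirteen explicit layers, blown up by a factor N, give 12 · 5206494576704 / 4000⁴ in
the limit. The limit exists because averaging over deletions of a point makes the maximum densities
antitone. -/

namespace PatternPacking

/-! ### Certified nonnegativity of integer polynomials on [0, 1] -/

/-- The value at `x` of the polynomial with the given coefficients, constant term first. -/
def listEval : List ℤ → ℝ → ℝ
  | [], _ => 0
  | a :: p, x => a + x * listEval p x

/-- A lower bound, by Horner's scheme, for the values of a polynomial on `[0, 1]`. -/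
def listLower : List ℤ → ℤ
  | [] => 0
  | a :: p => a + min 0 (listLower p)

/-- The coefficients of a positive multiple of `p (x / 2)`. -/
def listHalve : List ℤ → List ℤ
  | [] => []
  | a :: p => (a * 2 ^ p.length) :: listHalve p

/-- Coefficientwise addition. -/
def listAdd : List ℤ → List ℤ → List ℤ
  | [], q => q
  | p, [] => p
  | a :: p, b :: q => (a + b) :: listAdd p q

/-- The coefficients of `p (1 + x)`. -/
def listShift : List ℤ → List ℤ
  | [] => []
  | a :: p => listAdd [a] (listAdd (listShift p) (0 :: listShift p))

/-- A test, by repeated bisection, that a polynomial is nonnegative on `[0, 1]`. -/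
def listNonneg : ℕ → List ℤ → Bool
  | 0, p => decide (0 ≤ listLower p)
  | k + 1, p => decide (0 ≤ listLower p) ||
      (listNonneg k (listHalve p) && listNonneg k (listShift (listHalve p)))

theorem listLower_le {x : ℝ} (h0 : 0 ≤ x) (h1 : x ≤ 1) (p : List ℤ) :
    (listLower p : ℝ) ≤ listEval p x := by
  induction p with
  | nil => simp [listLower, listEval]
  | cons a p ih =>
    simp only [listLower, listEval]
    push_cast
    have : min 0 (listLower p : ℝ) ≤ x * listEval p x := by
      rcases le_total 0 (listEval p x) with h | h
      · exact (min_le_left _ _).trans (mul_nonneg h0 h)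
      · exact (min_le_right _ _).trans (ih.trans (by nlinarith))
    linarith

/-- Denominators are cleared by a power of 2 with exponent one less than the length; the factor 2 on
the left avoids a truncated subtraction there. -/
theorem listEval_halve (x : ℝ) (p : List ℤ) :
    2 * listEval (listHalve p) x = 2 ^ p.length * listEval p (x / 2) := by
  induction p with
  | nil => simp [listHalve, listEval]
  | cons a p ih =>
    simp only [listHalve, listEval, List.length_cons]
    push_cast
    linear_combination x * ih

theorem listEval_add (x : ℝ) (p q : List ℤ) :
    listEval (listAdd p q) x = listEval p x + listEval q x := by
  induction p generalizing q with
  | nil => simp [listAdd, listEval]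
  | cons a p ih =>
    cases q with
    | nil => simp [listAdd, listEval]
    | cons b q => simp only [listAdd, listEval, ih]; push_cast; ring

theorem listEval_shift (x : ℝ) (p : List ℤ) :
    listEval (listShift p) x = listEval p (1 + x) := by
  induction p with
  | nil => simp [listShift, listEval]
  | cons a p ih =>
    simp only [listShift, listEval, listEval_add, ih]
    push_cast
    ring

/-- The two recursive tests treat [0, 1/2] and [1/2, 1], each rescaled to [0, 1]; `k` bounds the
depth of bisection. -/
theorem listEval_nonneg {k : ℕ} {p : List ℤ} (h : listNonneg k p = true) {x : ℝ}
    (h0 : 0 ≤ x) (h1 : x ≤ 1) : 0 ≤ listEval p x := by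
  induction k generalizing p x with
  | zero =>
    have h' : 0 ≤ listLower p := by simpa [listNonneg] using h
    exact le_trans (by exact_mod_cast h') (listLower_le h0 h1 p)
  | succ k ih =>
    simp only [listNonneg, Bool.or_eq_true, Bool.and_eq_true, decide_eq_true_eq] at h
    rcases h with h | ⟨hl, hr⟩
    · exact le_trans (by exact_mod_cast h) (listLower_le h0 h1 p)
    · have hp : (0 : ℝ) < 2 ^ p.length := by positivity
      refine nonneg_of_mul_nonneg_right ?_ hp
      rcases le_total x (1 / 2) with hx | hx
      · have := ih hl (x := 2 * x) (by linarith) (by linarith)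
        have e := listEval_halve (2 * x) p
        rw [mul_div_cancel_left₀ x two_ne_zero] at e
        linarith
      · have := ih hr (x := 2 * x - 1) (by linarith) (by linarith)
        rw [listEval_shift, add_sub_cancel] at this
        have e := listEval_halve (2 * x) p
        rw [mul_div_cancel_left₀ x two_ne_zero] at e
        linarith

/-! ### The potential inequality for a single layer -/

/-- The potential on `[0, 1/2]`: an upper bound for the optimal value of the layers that fill
`[0, t]`. -/
noncomputable def potential (t : ℝ) : ℝ :=
  t ^ 3 * (1.85642816 - 1.79818672 * t + 0.00948863 * t ^ 2 - 0.01487022 * t ^ 3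
    + 0.03543870 * t ^ 4)

/-- The gain `potential b - potential (r * b)` minus the value of the layer from `r * b` to `b`,
divided by `b ^ 3 * (1 - r)`. -/
noncomputable def layerSlack (r b : ℝ) : ℝ :=
  1.85642816 * (1 + r + r ^ 2) - 1.79818672 * b * (1 + r + r ^ 2 + r ^ 3)
    + 0.00948863 * b ^ 2 * (1 + r + r ^ 2 + r ^ 3 + r ^ 4)
    - 0.01487022 * b ^ 3 * (1 + r + r ^ 2 + r ^ 3 + r ^ 4 + r ^ 5)
    + 0.03543870 * b ^ 4 * (1 + r + r ^ 2 + r ^ 3 + r ^ 4 + r ^ 5 + r ^ 6)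
    - 12 * (r - r ^ 2) * (1 - b)

/-- The derivative of `layerSlack` in its first variable. -/
noncomputable def layerSlackDeriv (r b : ℝ) : ℝ :=
  1.85642816 * (1 + 2 * r) - 1.79818672 * b * (1 + 2 * r + 3 * r ^ 2)
    + 0.00948863 * b ^ 2 * (1 + 2 * r + 3 * r ^ 2 + 4 * r ^ 3)
    - 0.01487022 * b ^ 3 * (1 + 2 * r + 3 * r ^ 2 + 4 * r ^ 3 + 5 * r ^ 4)
    + 0.03543870 * b ^ 4 * (1 + 2 * r + 3 * r ^ 2 + 4 * r ^ 3 + 5 * r ^ 4 + 6 * r ^ 5)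
    - 12 * (1 - 2 * r) * (1 - b)

/-- An approximation of the minimizer of `layerSlack` for given `b`. -/
noncomputable def nearMin (b : ℝ) : ℝ :=
  0.36595 + 0.02679 * b - 0.01454 * b ^ 2 + 0.12602 * b ^ 3

/-- Substituting `nearMin b` for the ratio leaves a polynomial in b alone. The list holds its
coefficients in x = 2b with denominators cleared. The margin is tiny because the potential is nearly
optimal. -/
theorem layerSlack_nearMin {b : ℝ} (h0 : 0 ≤ b) (h1 : b ≤ 1 / 2) :
    0.00000023 ≤ layerSlack (nearMin b) b := by
  have h := listEval_nonneg (k := 8) (p :=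
    [21230468054646784000000000000000000000, -281225135551245536460800000000000000000,
     1350814656147383914244331520000000000000, -2963031585311453675155891757568000000000,
     3491825117918288217366182633814208000000, -3173753500238904133592494288830963200000,
     2783824533651300221651998021275868800000, -1226273274107853850495940129280618240000,
     -2411114479616416751374603254571488000, 84466983452590786922974103921844480,
     -1074410781689892437446572387765847872, 98942350098458817811308302061263616,
     -33939181812207727635917776589130624, 25260709939992751689229160520290240,
     1867364225500945586622747124518800, -568138200284938545400445544424704,
     408952185726729067271656340830032, 22653067002132544910552942076912,
     -6071105410054664666464779176940, 4363355879523424316677136010480,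
     130871185027685197078952206656, -30707243811041573184542794188,
     22178627149630095441976632987])
    (by decide +kernel)
    (x := 2 * b) (by linarith) (by linarith)
  refine sub_nonneg.1 (nonneg_of_mul_nonneg_right (a := (655360000000000000000000000000000000000000 : ℝ))
    (le_of_le_of_eq h ?_) (by norm_num))
  simp only [listEval, layerSlack, nearMin]
  push_cast
  ring

theorem neg_le_layerSlackDeriv_nearMin {b : ℝ} (h0 : 0 ≤ b) (h1 : b ≤ 1 / 2) :
    0 ≤ layerSlackDeriv (nearMin b) b + 0.0021 := by
  have h := listEval_nonneg (k := 8) (p :=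
    [39264505036800000000000000000000, 50344577870764277760000000000000000,
     -251068538374682064878592000000000000, 400656416327842603625841216000000000,
     -199033456919842499423703592195200000, -573064185034096706804743681600000,
     54620948889121217931660775680000, -350600485827635836213616124672000,
     16626428072054002918840822494400, -6815919029206911825871528981152,
     6099531907163053499738107387680, 443218114045217931923682528400,
     -152582077534017956095153818720, 131310098459770968563067212880,
     7020037909031379418765347216, -2025719721428664442228034040, 1742440755387686097891593820,
     50519056082044675302841950, -12183480324964915562824470, 10559574900633278261534661])
    (by decide +kernel)
    (x := 2 * b) (by linarith) (by linarith)
  refine nonneg_of_mul_nonneg_right (a := (819200000000000000000000000000000000 : ℝ))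
    (le_of_le_of_eq h ?_) (by norm_num)
  simp only [listEval, layerSlackDeriv, nearMin]
  push_cast
  ring

theorem layerSlackDeriv_nearMin_le {b : ℝ} (h0 : 0 ≤ b) (h1 : b ≤ 1 / 2) :
    0 ≤ 0.0021 - layerSlackDeriv (nearMin b) b := by
  have h := listEval_nonneg (k := 8) (p :=
    [3401375494963200000000000000000000, -50344577870764277760000000000000000,
     251068538374682064878592000000000000, -400656416327842603625841216000000000,
     199033456919842499423703592195200000, 573064185034096706804743681600000,
     -54620948889121217931660775680000, 350600485827635836213616124672000,
     -16626428072054002918840822494400, 6815919029206911825871528981152,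
     -6099531907163053499738107387680, -443218114045217931923682528400,
     152582077534017956095153818720, -131310098459770968563067212880,
     -7020037909031379418765347216, 2025719721428664442228034040, -1742440755387686097891593820,
     -50519056082044675302841950, 12183480324964915562824470, -10559574900633278261534661])
    (by decide +kernel)
    (x := 2 * b) (by linarith) (by linarith)
  refine nonneg_of_mul_nonneg_right (a := (819200000000000000000000000000000000 : ℝ))
    (le_of_le_of_eq h ?_) (by norm_num)
  simp only [listEval, layerSlackDeriv, nearMin]
  push_cast
  ring

/-- The symmetric case, with middle layer [m, 1 - m]; it is the endpoint d = 0 in `middle_layer_le`.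
-/
theorem two_potential_add_le {m : ℝ} (h0 : 0 ≤ m) (h1 : m ≤ 1 / 2) :
    2 * potential m + 12 * (1 - 2 * m) ^ 2 * m ^ 2 ≤ 0.24405453999 := by
  have h := listEval_nonneg (k := 16) (p :=
    [97621815996, 0, -1200000000000, 2214357184000, -1110090664000, -237215750, 185877750,
     -221491875])
    (by decide +kernel)
    (x := 2 * m) (by linarith) (by linarith)
  refine sub_nonneg.1 (nonneg_of_mul_nonneg_right (a := (400000000000 : ℝ))
    (le_of_le_of_eq h ?_) (by norm_num))
  simp only [listEval, potential]
  push_cast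
  ring

/-- The part of half the second derivative of `potential` that bounds its symmetric second
differences. -/
noncomputable def potentialCurvature (m : ℝ) : ℝ :=
  1.85642816 * (3 * m) - 1.79818672 * (6 * m ^ 2) + 0.00948863 * (10 * m ^ 3)
    - 0.01487022 * (15 * m ^ 4) + 0.03543870 * (21 * m ^ 5)

/-- The opposite endpoint d² = (1/2 - m)² in `middle_layer_le`. -/
theorem two_potential_add_le_sub {m : ℝ} (h0 : 0 ≤ m) (h1 : m ≤ 1 / 2) :
    2 * potential m + 12 * (1 - 2 * m) ^ 2 * m ^ 2 ≤ 0.24405453999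
      + (1 / 2 - m) ^ 2 * (12 * (1 - 2 * m) ^ 2 - 2 * potentialCurvature m) := by
  have h := listEval_nonneg (k := 16) (p :=
    [1297621815996, -5356928448000, 7653312912000, -4223855453500, 636897833250, -12837035125,
     12276702750, -4872821250])
    (by decide +kernel)
    (x := 2 * m) (by linarith) (by linarith)
  refine sub_nonneg.1 (nonneg_of_mul_nonneg_right (a := (400000000000 : ℝ))
    (le_of_le_of_eq h ?_) (by norm_num))
  simp only [listEval, potential, potentialCurvature]
  push_cast
  ring

/-- The second-order remainder of `layerSlack` around `x` in its first variable. -/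
noncomputable def layerSlackRem (r x b : ℝ) : ℝ :=
  1.85642816 - 1.79818672 * b * (1 + (r + 2 * x))
    + 0.00948863 * b ^ 2 * (1 + (r + 2 * x) + (r ^ 2 + 2 * x * r + 3 * x ^ 2))
    - 0.01487022 * b ^ 3 * (1 + (r + 2 * x) + (r ^ 2 + 2 * x * r + 3 * x ^ 2)
      + (r ^ 3 + 2 * x * r ^ 2 + 3 * x ^ 2 * r + 4 * x ^ 3))
    + 0.03543870 * b ^ 4 * (1 + (r + 2 * x) + (r ^ 2 + 2 * x * r + 3 * x ^ 2)
      + (r ^ 3 + 2 * x * r ^ 2 + 3 * x ^ 2 * r + 4 * x ^ 3)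
      + (r ^ 4 + 2 * x * r ^ 3 + 3 * x ^ 2 * r ^ 2 + 4 * x ^ 3 * r + 5 * x ^ 4))
    + 12 * (1 - b)

theorem layerSlack_eq (r x b : ℝ) :
    layerSlack r b =
      layerSlack x b + layerSlackDeriv x b * (r - x) + (r - x) ^ 2 * layerSlackRem r x b := by
  simp only [layerSlack, layerSlackDeriv, layerSlackRem]
  ring

/-- The term 12 (1 - b) ≥ 6 dominates: together with 1.856 it outweighs the loss of at most 1.8 · b
· 2.8, and the higher terms are negligible. -/
theorem five_le_layerSlackRem {r x b : ℝ} (hr0 : 0 ≤ r) (hr1 : r ≤ 1) (hx0 : 0 ≤ x)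
    (hx1 : x ≤ 0.4) (h0 : 0 ≤ b) (h1 : b ≤ 1 / 2) : 5 ≤ layerSlackRem r x b := by
  have hb2 : b ^ 3 ≤ b ^ 2 / 2 := by nlinarith [sq_nonneg b]
  have hA : b * (r + 2 * x) ≤ b * 1.8 := by gcongr; linarith
  have hu : r ^ 3 + 2 * x * r ^ 2 + 3 * x ^ 2 * r + 4 * x ^ 3 ≤
      1 ^ 3 + 2 * 0.4 * 1 ^ 2 + 3 * 0.4 ^ 2 * 1 + 4 * 0.4 ^ 3 := by gcongr
  have hv : 0 ≤ r ^ 2 + 2 * x * r + 3 * x ^ 2 := by positivity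
  have hB : b ^ 3 * (r ^ 3 + 2 * x * r ^ 2 + 3 * x ^ 2 * r + 4 * x ^ 3) ≤ (1 / 2) ^ 3 * 3 := by
    gcongr
    exact hu.trans (by norm_num)
  have hC : b ^ 3 * (1 + (r + 2 * x) + (r ^ 2 + 2 * x * r + 3 * x ^ 2)) ≤
      b ^ 2 / 2 * (1 + (r + 2 * x) + (r ^ 2 + 2 * x * r + 3 * x ^ 2)) := by gcongr
  have hD : 0 ≤ b ^ 2 * (1 + (r + 2 * x) + (r ^ 2 + 2 * x * r + 3 * x ^ 2)) := by positivity
  have hE : 0 ≤ b ^ 4 * (1 + (r + 2 * x) + (r ^ 2 + 2 * x * r + 3 * x ^ 2)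
      + (r ^ 3 + 2 * x * r ^ 2 + 3 * x ^ 2 * r + 4 * x ^ 3)
      + (r ^ 4 + 2 * x * r ^ 3 + 3 * x ^ 2 * r ^ 2 + 4 * x ^ 3 * r + 5 * x ^ 4)) := by
    positivity
  unfold layerSlackRem
  linarith

theorem layerSlack_nonneg {r b : ℝ} (hr0 : 0 ≤ r) (hr1 : r ≤ 1) (h0 : 0 ≤ b)
    (h1 : b ≤ 1 / 2) : 0 ≤ layerSlack r b := by
  have hb2 : b ^ 2 ≤ 1 / 4 := by nlinarith
  have hb3 : b ^ 3 ≤ (1 / 2) ^ 3 := by gcongr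
  have hb3' : 0 ≤ b ^ 3 := by positivity
  have hx0 : 0 ≤ nearMin b := by unfold nearMin; nlinarith
  have hx1 : nearMin b ≤ 0.4 := by unfold nearMin; nlinarith
  rw [layerSlack_eq r (nearMin b) b]
  have e1 := layerSlack_nearMin h0 h1
  have e2 := neg_le_layerSlackDeriv_nearMin h0 h1
  have e3 := layerSlackDeriv_nearMin_le h0 h1
  have e4 := mul_le_mul_of_nonneg_left (five_le_layerSlackRem hr0 hr1 hx0 hx1 h0 h1)
    (sq_nonneg (r - nearMin b))
  -- The slack is at least 0.00000023 - 0.0021 |s| + 5 s². Completing the square at |s| = 0.0021 /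
  -- 10 = 0.00021 costs 0.0000002205, which is within the margin.
  set s := r - nearMin b
  rcases le_total 0 s with hs | hs
  · nlinarith [mul_nonneg e2 hs, sq_nonneg (s - 0.00021)]
  · nlinarith [mul_nonneg e3 (neg_nonneg.2 hs), sq_nonneg (s + 0.00021)]

/-- Layers inside `[0, 1/2]` are paid for by the potential. -/
theorem layer_le_potential_sub {a b : ℝ} (ha : 0 ≤ a) (hab : a ≤ b) (hb : b ≤ 1 / 2) :
    12 * (b - a) ^ 2 * a * (1 - b) ≤ potential b - potential a := by
  rcases (ha.trans hab).eq_or_lt with h | h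
  · obtain rfl : a = b := le_antisymm hab (h ▸ ha)
    simp
  · obtain ⟨r, rfl⟩ : ∃ r, a = r * b := ⟨a / b, by field_simp⟩
    have hr0 : 0 ≤ r := nonneg_of_mul_nonneg_left ha h
    have hr1 : r ≤ 1 := by
      by_contra hr
      nlinarith
    have := mul_nonneg (mul_nonneg (pow_nonneg h.le 3) (sub_nonneg.2 hr1))
      (layerSlack_nonneg hr0 hr1 h.le hb)
    refine sub_nonneg.1 (this.trans_eq ?_)
    unfold layerSlack potential
    ring

/-- Odd powers of d cancel, the d² terms give the curvature, and the terms of order d⁴ and d⁶ are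
together nonpositive. -/
theorem potential_add_potential_le {m d : ℝ} (hm : 0 ≤ m) (hm' : m ≤ 1 / 2)
    (hd : d ^ 2 ≤ 1 / 4) : potential (m + d) + potential (m - d) ≤
      2 * potential m + 2 * d ^ 2 * potentialCurvature m := by
  have hm3 : m ^ 3 ≤ (1 / 2) ^ 3 := by gcongr
  have h1 : 0 ≤ 1.79818672 - 0.00948863 * (5 * m) + 0.01487022 * (15 * m ^ 2 + d ^ 2)
      - 0.03543870 * (35 * m ^ 3 + 7 * m * d ^ 2) := by
    have : m * d ^ 2 ≤ 1 / 2 * (1 / 4) := by gcongr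
    nlinarith [sq_nonneg m, sq_nonneg d]
  refine sub_nonneg.1 ((mul_nonneg (mul_nonneg zero_le_two (sq_nonneg (d ^ 2))) h1).trans_eq ?_)
  unfold potential potentialCurvature
  ring

/-- The layer around `1/2` is paid for by the potentials on both sides. -/
theorem middle_layer_le {a s : ℝ} (ha : 0 ≤ a) (hs : 0 ≤ s) (ha' : a ≤ 1 / 2)
    (hs' : s ≤ 1 / 2) :
    12 * (1 - s - a) ^ 2 * a * s ≤ 0.24405453999 - potential s - potential a := by
  obtain ⟨m, d, rfl, rfl⟩ : ∃ m d, a = m + d ∧ s = m - d :=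
    ⟨(a + s) / 2, (a - s) / 2, by ring, by ring⟩
  have hm : 0 ≤ m := by linarith
  have hm' : m ≤ 1 / 2 := by linarith
  have hd : d ^ 2 ≤ (1 / 2 - m) ^ 2 := by
    rcases le_total 0 d with h | h <;> nlinarith
  have hd' : d ^ 2 ≤ 1 / 4 := hd.trans (by nlinarith)
  have h1 := potential_add_potential_le hm hm' hd'
  have h2 := two_potential_add_le hm hm'
  have h3 := two_potential_add_le_sub hm hm'
  -- The bound is affine in d², so it suffices to check d² = 0 and d² = (1/2 - m)².
  have h4 : 2 * potential m + 12 * (1 - 2 * m) ^ 2 * m ^ 2 ≤ 0.24405453999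
      + d ^ 2 * (12 * (1 - 2 * m) ^ 2 - 2 * potentialCurvature m) := by
    rcases le_total 0 (12 * (1 - 2 * m) ^ 2 - 2 * potentialCurvature m) with h | h
    · have := mul_nonneg (sq_nonneg d) h
      linarith
    · have := mul_le_mul_of_nonpos_right hd h
      linarith
  linarith

/-- The potential on `[0, 1]`, extended from `[0, 1/2]` by symmetry. -/
noncomputable def fullPotential (t : ℝ) : ℝ :=
  if t ≤ 1 / 2 then potential t else 0.24405453999 - potential (1 - t)

/-- Both sides are invariant under (a, b) ↦ (1 - b, 1 - a), which carries layers in the right half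
to the left half; a layer straddling 1/2 is the middle one. -/
theorem layer_le_fullPotential_sub {a b : ℝ} (ha : 0 ≤ a) (hab : a ≤ b) (hb : b ≤ 1) :
    12 * (b - a) ^ 2 * a * (1 - b) ≤ fullPotential b - fullPotential a := by
  unfold fullPotential
  split_ifs with h1 h2 h2
  · exact layer_le_potential_sub ha hab h1
  · linarith
  · have := middle_layer_le (a := a) (s := 1 - b) ha (by linarith) h2 (by linarith)
    refine le_trans (le_of_eq ?_) this
    ring
  · have := layer_le_potential_sub (a := 1 - b) (b := 1 - a) (by linarith) (by linarith)
      (by linarith)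
    refine (le_of_eq ?_).trans (this.trans (le_of_eq ?_)) <;> ring

theorem fullPotential_one_sub_zero : fullPotential 1 - fullPotential 0 = 0.24405453999 := by
  norm_num [fullPotential, potential]

/-! ### Diamonds in weighted strict orders -/

open Classical in
/-- The indicator that `a` lies below `b` and `c`, both of which lie below `d`, while `b` and `c`
are incomparable or equal. -/
noncomputable def diamond {α : Type*} (r : α → α → Prop) (a b c d : α) : ℝ :=
  if r a b ∧ r a c ∧ r b d ∧ r c d ∧ ¬ r b c ∧ ¬ r c b then 1 else 0

/-- The weighted number of diamonds. -/
noncomputable def diamondSum {α : Type*} [Fintype α] (r : α → α → Prop) (w : α → ℝ) : ℝ :=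
  ∑ a, ∑ d, ∑ b, ∑ c, w a * w d * (w b * w c) * diamond r a b c d

/-- If the mixed terms are 1, then x and y both lie between a and d, so by irreflexivity both
diagonal terms are 1. -/
theorem diamond_self_ge {α : Type*} {r : α → α → Prop} (hr : ∀ a, ¬ r a a) (x y a d : α) :
    0 ≤ diamond r a x x d - diamond r a y x d - (diamond r a x y d - diamond r a y y d) := by
  have hx := hr x
  have hy := hr y
  unfold diamond
  split_ifs <;> first | norm_num; done | (exfalso; tauto)

/-- Moving weight between two incomparable elements changes the number of diamonds by a convex
quadratic polynomial. -/
theorem diamondSum_add_mul {α : Type*} [Fintype α] [DecidableEq α] {r : α → α → Prop}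
    (hr : ∀ a, ¬ r a a) (htrans : ∀ a b c, r a b → r b c → r a c) {w : α → ℝ}
    (hw : ∀ i, 0 ≤ w i) {x y : α} (hxy : ¬ r x y) (hyx : ¬ r y x) :
    ∃ B C : ℝ, 0 ≤ C ∧ ∀ t : ℝ,
      diamondSum r (fun i => w i + t * ((Pi.single x 1 : α → ℝ) i - (Pi.single y 1 : α → ℝ) i)) =
        diamondSum r w + t * B + t ^ 2 * C := by
  set v : α → ℝ := fun i => (Pi.single x 1 : α → ℝ) i - (Pi.single y 1 : α → ℝ) i with hv
  -- Related elements cannot both change weight. In a diamond only b and c are unrelated, so b, c is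
  -- the only pair whose weights can both move.
  have hv0 : ∀ i j, r i j → v i * v j = 0 := by
    intro i j hij
    by_contra h
    have hi : i = x ∨ i = y := by
      by_contra h'
      push Not at h'
      exact h (by simp [hv, h'.1, h'.2])
    have hj : j = x ∨ j = y := by
      by_contra h'
      push Not at h'
      exact h (by simp [hv, h'.1, h'.2])
    rcases hi with rfl | rfl <;> rcases hj with rfl | rfl
    · exact hr _ hij
    · exact hxy hij
    · exact hyx hij
    · exact hr _ hij
  refine ⟨∑ a, ∑ d, ∑ b, ∑ c, (v a * w d * (w b * w c) + w a * v d * (w b * w c)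
      + w a * w d * (v b * w c) + w a * w d * (w b * v c)) * diamond r a b c d,
    ∑ a, ∑ d, ∑ b, ∑ c, w a * w d * (v b * v c) * diamond r a b c d, ?_, fun t => ?_⟩
  · have hsum : ∀ g : α → ℝ, ∑ i, v i * g i = g x - g y := fun g => by
      simp [hv, sub_mul, Finset.sum_sub_distrib, Pi.single_apply]
    refine Finset.sum_nonneg fun a _ => Finset.sum_nonneg fun d _ => ?_
    have e : ∑ b, ∑ c, w a * w d * (v b * v c) * diamond r a b c d =
        w a * w d * ∑ b, v b * ∑ c, v c * diamond r a b c d := by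
      simp only [Finset.mul_sum]
      refine Finset.sum_congr rfl fun b _ => Finset.sum_congr rfl fun c _ => ?_
      ring
    rw [e, hsum, hsum, hsum]
    refine mul_nonneg (mul_nonneg (hw a) (hw d)) ((diamond_self_ge hr x y a d).trans_eq ?_)
    ring
  · simp only [diamondSum, Finset.mul_sum, ← Finset.sum_add_distrib]
    refine Finset.sum_congr rfl fun a _ => Finset.sum_congr rfl fun d _ =>
      Finset.sum_congr rfl fun b _ => Finset.sum_congr rfl fun c _ => ?_
    by_cases hK : r a b ∧ r a c ∧ r b d ∧ r c d ∧ ¬ r b c ∧ ¬ r c b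
    · have h1 := hv0 a b hK.1
      have h2 := hv0 a c hK.2.1
      have h3 := hv0 b d hK.2.2.1
      have h4 := hv0 c d hK.2.2.2.1
      have h5 := hv0 a d (htrans _ _ _ hK.1 hK.2.2.1)
      simp only [diamond, if_pos hK]
      linear_combination (t ^ 2 * (w d + t * v d) * (w c + t * v c)) * h1
        + (t ^ 2 * w b * (w d + t * v d)) * h2 + (t ^ 2 * w a * (w c + t * v c)) * h3
        + (t ^ 2 * w a * w b) * h4 + (t ^ 2 * w b * w c) * h5
    · simp [diamond, if_neg hK]

/-- If the support of the weights is a chain, they define a sequence of layers. -/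
theorem diamondSum_le_of_chain {n : ℕ} {r : Fin n → Fin n → Prop} (hlt : ∀ i j, r i j → i < j)
    {w : Fin n → ℝ} (hw : ∀ i, 0 ≤ w i) (hw1 : ∑ i, w i = 1)
    (hchain : ∀ i j, i ≠ j → w i ≠ 0 → w j ≠ 0 → r i j ∨ r j i) :
    12 * diamondSum r w ≤ 0.24405453999 := by
  -- The element b becomes the layer from W b to W (b + 1).
  set W : ℕ → ℝ := fun k => ∑ i : Fin n, if i.val < k then w i else 0 with hW
  have hsucc : ∀ b : Fin n, W (b + 1) = W b + w b := by
    intro b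
    have : w b = ∑ i : Fin n, if i = b then w i else 0 := by simp
    rw [this]
    simp only [hW]
    rw [← Finset.sum_add_distrib]
    refine Finset.sum_congr rfl fun i _ => ?_
    rcases lt_trichotomy i b with h | h | h
    · have : i.val < b.val := h
      simp [this, h.ne, Nat.lt_succ_of_lt this]
    · subst h
      simp
    · have : b.val < i.val := h
      rw [if_neg (by omega), if_neg (by omega), if_neg h.ne', add_zero]
  have hgt : ∀ b : Fin n, (∑ i : Fin n, if b < i then w i else 0) = 1 - W (b + 1) := by
    intro b
    rw [eq_sub_iff_add_eq, ← hw1]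
    simp only [hW]
    rw [← Finset.sum_add_distrib]
    refine Finset.sum_congr rfl fun i _ => ?_
    by_cases h : b < i
    · have : b.val < i.val := h
      rw [if_pos h, if_neg (by omega), add_zero]
    · have : ¬ b.val < i.val := h
      rw [if_neg h, if_pos (by omega), zero_add]
  have hle : diamondSum r w ≤
      ∑ b : Fin n, w b ^ 2 * (W b * ∑ d : Fin n, if b < d then w d else 0) := by
    have hterm : ∀ a d b : Fin n,
        ∑ c, w a * w d * (w b * w c) * diamond r a b c d ≤
          w b ^ 2 * ((if a.val < b.val then w a else 0) * (if b < d then w d else 0)) := by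
      intro a d b
      -- Distinct elements of the support are comparable, so only c = b contributes.
      rw [Finset.sum_eq_single b]
      · have h0 : 0 ≤ w a * w d * (w b * w b) := by
          have := hw a
          have := hw d
          have := hw b
          positivity
        unfold diamond
        split_ifs with h1 h2 h3 h3
        · exact le_of_eq (by ring)
        · exact absurd (hlt _ _ h1.2.2.1) h3
        · exact absurd (hlt _ _ h1.1) h2
        · exact absurd (hlt _ _ h1.1) h2
        all_goals simp
        exact mul_nonneg (sq_nonneg _) (mul_nonneg (hw a) (hw d))
      · intro c _ hcb
        by_cases hb0 : w b = 0
        · simp [hb0]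
        by_cases hc0 : w c = 0
        · simp [hc0]
        have : diamond r a b c d = 0 := by
          unfold diamond
          rw [if_neg]
          rintro ⟨-, -, -, -, h1, h2⟩
          exact (hchain c b hcb hc0 hb0).elim h2 h1
        simp [this]
      · simp
    have e : ∑ b : Fin n, w b ^ 2 * (W b * ∑ d : Fin n, if b < d then w d else 0) =
        ∑ a : Fin n, ∑ d : Fin n, ∑ b : Fin n,
          w b ^ 2 * ((if a.val < b.val then w a else 0) * (if b < d then w d else 0)) := by
      simp only [hW, Finset.sum_mul_sum]
      simp only [Finset.mul_sum]
      rw [Finset.sum_comm]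
      exact Finset.sum_congr rfl fun a _ => Finset.sum_comm
    rw [e]
    exact Finset.sum_le_sum fun a _ => Finset.sum_le_sum fun d _ => Finset.sum_le_sum fun b _ =>
      hterm a d b
  have hW0 : W 0 = 0 := by simp [hW]
  have hWn : W n = 1 := by simp [hW, hw1]
  have hWnonneg : ∀ k, 0 ≤ W k := fun k => Finset.sum_nonneg fun i _ => by
    split_ifs
    exacts [hw i, le_rfl]
  have hWle : ∀ k, W k ≤ 1 := fun k => by
    rw [← hw1]
    refine Finset.sum_le_sum fun i _ => ?_
    split_ifs
    exacts [le_rfl, hw i]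
  calc 12 * diamondSum r w
      ≤ 12 * ∑ b : Fin n, w b ^ 2 * (W b * ∑ d : Fin n, if b < d then w d else 0) := by gcongr
    _ = ∑ b : Fin n, 12 * (W (b + 1) - W b) ^ 2 * W b * (1 - W (b + 1)) := by
        rw [Finset.mul_sum]
        refine Finset.sum_congr rfl fun b _ => ?_
        rw [hgt, hsucc]
        ring
    _ ≤ ∑ b : Fin n, (fullPotential (W (b + 1)) - fullPotential (W b)) := by
        refine Finset.sum_le_sum fun b _ => layer_le_fullPotential_sub (hWnonneg _) ?_ (hWle _)
        rw [hsucc]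
        linarith [hw b]
    _ = fullPotential (W n) - fullPotential (W 0) := by
        rw [Fin.sum_univ_eq_sum_range (fun k => fullPotential (W (k + 1)) - fullPotential (W k)) n,
          Finset.sum_range_sub (fun k => fullPotential (W k))]
    _ = 0.24405453999 := by rw [hWn, hW0, fullPotential_one_sub_zero]

/-- The number of diamonds for weights of total mass `1` on a strict order. -/
theorem diamondSum_le {n : ℕ} {r : Fin n → Fin n → Prop} (hlt : ∀ i j, r i j → i < j)
    (htrans : ∀ i j k, r i j → r j k → r i k) {w : Fin n → ℝ} (hw : ∀ i, 0 ≤ w i)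
    (hw1 : ∑ i, w i = 1) : 12 * diamondSum r w ≤ 0.24405453999 := by
  induction hk : (Finset.univ.filter fun i => w i ≠ 0).card using Nat.strong_induction_on
    generalizing w with
  | _ k ih =>
  by_cases hchain : ∀ i j, i ≠ j → w i ≠ 0 → w j ≠ 0 → r i j ∨ r j i
  · exact diamondSum_le_of_chain hlt hw hw1 hchain
  push Not at hchain
  obtain ⟨x, y, hne, hx, hy, hxy, hyx⟩ := hchain
  obtain ⟨B, C, hC, hBC⟩ :=
    diamondSum_add_mul (fun a h => lt_irrefl a (hlt a a h)) htrans hw hxy hyx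
  set w' : ℝ → Fin n → ℝ := fun t i =>
    w i + t * ((Pi.single x 1 : Fin n → ℝ) i - (Pi.single y 1 : Fin n → ℝ) i) with hw'
  have hwx : ∀ t, w' t x = w x + t := fun t => by simp [hw', hne]
  have hwy : ∀ t, w' t y = w y - t := fun t => by simp [hw', hne.symm, sub_eq_add_neg]
  have hwz : ∀ t z, z ≠ x → z ≠ y → w' t z = w z := fun t z h1 h2 => by simp [hw', h1, h2]
  have hsum : ∀ t, ∑ i, w' t i = 1 := fun t => by
    simp [hw', Finset.sum_add_distrib, ← Finset.mul_sum, Finset.sum_sub_distrib, hw1]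
  -- At either endpoint x or y loses all its weight, so the support shrinks and induction applies.
  have key : ∀ t, -w x ≤ t → t ≤ w y → (t = -w x ∨ t = w y) →
      12 * diamondSum r (w' t) ≤ 0.24405453999 := by
    intro t h1 h2 h3
    refine ih _ ?_ (fun i => ?_) (hsum t) rfl
    · rw [← hk]
      refine Finset.card_lt_card (Finset.ssubset_iff_of_subset ?_ |>.2 ?_)
      · intro i hi
        simp only [Finset.mem_filter, Finset.mem_univ, true_and] at hi ⊢
        by_cases hix : i = x
        · rwa [hix]
        by_cases hiy : i = y
        · rwa [hiy]
        rwa [hwz t i hix hiy] at hi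
      · rcases h3 with rfl | rfl
        · exact ⟨x, by simp [hx], by simp [hwx]⟩
        · exact ⟨y, by simp [hy], by simp [hwy]⟩
    · by_cases hix : i = x
      · rw [hix, hwx]; linarith
      by_cases hiy : i = y
      · rw [hiy, hwy]; linarith
      rw [hwz t i hix hiy]
      exact hw i
  have hx0 := hw x
  have hy0 := hw y
  -- Since C ≥ 0, moving in the direction given by the sign of B does not decrease the sum.
  rcases le_total 0 B with hB | hB
  · have h1 := key (w y) (by linarith) le_rfl (Or.inr rfl)
    rw [hBC] at h1
    nlinarith [mul_nonneg hy0 hB, mul_nonneg (sq_nonneg (w y)) hC]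
  · have h1 := key (-w x) le_rfl (by linarith) (Or.inl rfl)
    rw [hBC] at h1
    nlinarith [mul_nonneg hx0 (neg_nonneg.2 hB), mul_nonneg (sq_nonneg (w x)) hC]

/-! ### From occurrences to diamonds -/

/-- Every occurrence of 1324 is a diamond in the order of a permutation, in two ways. -/
theorem two_mul_occurrences_le {n : ℕ} (P : Equiv.Perm (Fin n)) :
    2 * (occurrences perm1324 P : ℝ) ≤
      diamondSum (fun i j => i < j ∧ P i < P j) (fun _ : Fin n => (1 : ℝ)) := by
  classical
  set r : Fin n → Fin n → Prop := fun i j => i < j ∧ P i < P j with hr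
  set S : Finset (Fin n × Fin n × Fin n × Fin n) := Finset.univ.filter fun q =>
    r q.1 q.2.2.1 ∧ r q.1 q.2.2.2 ∧ r q.2.2.1 q.2.1 ∧ r q.2.2.2 q.2.1 ∧
      ¬ r q.2.2.1 q.2.2.2 ∧ ¬ r q.2.2.2 q.2.2.1 with hS
  have hsum : diamondSum r (fun _ : Fin n => (1 : ℝ)) = (S.card : ℝ) := by
    rw [hS, ← Finset.sum_boole]
    simp only [diamondSum, one_mul, diamond, Fintype.sum_prod_type]
    exact Finset.sum_congr rfl fun a _ => Finset.sum_congr rfl fun d _ =>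
      Finset.sum_congr rfl fun b _ => Finset.sum_congr rfl fun c _ => by congr!
  -- Quadruples are listed as (a, d, b, c); the Boolean decides whether the two middle points are
  -- swapped.
  let φ : {e : Fin 4 ↪o Fin n // ∀ i j : Fin 4, perm1324 i < perm1324 j ↔ P (e i) < P (e j)} × Bool
      → S := fun x => ⟨if x.2 then (x.1.1 0, x.1.1 3, x.1.1 1, x.1.1 2)
        else (x.1.1 0, x.1.1 3, x.1.1 2, x.1.1 1), by
    obtain ⟨⟨e, he⟩, t⟩ := x
    have h01 : e 0 < e 1 := e.strictMono (by decide)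
    have h02 : e 0 < e 2 := e.strictMono (by decide)
    have h13 : e 1 < e 3 := e.strictMono (by decide)
    have h23 : e 2 < e 3 := e.strictMono (by decide)
    have h12 : e 1 < e 2 := e.strictMono (by decide)
    have k01 := (he 0 1).1 (by decide)
    have k02 := (he 0 2).1 (by decide)
    have k13 := (he 1 3).1 (by decide)
    have k23 := (he 2 3).1 (by decide)
    have k21 := (he 2 1).1 (by decide)
    cases t <;>
      simp [hS, hr, h01, h02, h13, h23, h12, k01, k02, k13, k23, k21.le]⟩
  have hφ : Function.Injective φ := by
    rintro ⟨⟨e, he⟩, t⟩ ⟨⟨e', he'⟩, t'⟩ h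
    have h12 : e 1 < e 2 := e.strictMono (by decide)
    have h12' : e' 1 < e' 2 := e'.strictMono (by decide)
    have h' := congrArg Subtype.val h
    have aux : ∀ h0 : e 0 = e' 0, e 1 = e' 1 → e 2 = e' 2 → e 3 = e' 3 → e = e' := by
      intro h0 h1 h2 h3
      ext i
      fin_cases i <;> simp [h0, h1, h2, h3]
    cases t <;> cases t' <;> simp [φ] at h'
    · simp [aux h'.1 h'.2.2.2 h'.2.2.1 h'.2.1]
    · rw [h'.2.2.1, h'.2.2.2] at h12
      exact absurd h12 h12'.not_gt
    · rw [h'.2.2.1, h'.2.2.2] at h12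
      exact absurd h12 h12'.not_gt
    · simp [aux h'.1 h'.2.2.1 h'.2.2.2 h'.2.1]
  have := Nat.card_le_card_of_injective φ hφ
  rw [Nat.card_prod, Nat.card_eq_fintype_card (α := Bool), Fintype.card_bool,
    Nat.card_eq_fintype_card (α := S), Fintype.card_coe] at this
  rw [hsum, mul_comm]
  exact_mod_cast this

/-- Uniform weights 1/n and homogeneity of degree 4; 24 = 2 · 12, as each occurrence gives two
diamonds. -/
theorem occurrences_le {n : ℕ} (hn : 0 < n) (P : Equiv.Perm (Fin n)) :
    24 * (occurrences perm1324 P : ℝ) ≤ 0.24405453999 * (n : ℝ) ^ 4 := by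
  have hn' : (n : ℝ) ≠ 0 := by positivity
  have h1 := two_mul_occurrences_le P
  have h2 := diamondSum_le (r := fun i j => i < j ∧ P i < P j) (fun i j h => h.1)
    (fun i j k h h' => ⟨h.1.trans h'.1, h.2.trans h'.2⟩) (w := fun _ => (n : ℝ)⁻¹)
    (fun i => by positivity) (by simp [hn'])
  have h3 : diamondSum (fun i j => i < j ∧ P i < P j) (fun _ : Fin n => (1 : ℝ)) =
      (n : ℝ) ^ 4 *
        diamondSum (fun i j => i < j ∧ P i < P j) (fun _ : Fin n => (n : ℝ)⁻¹) := by
    simp only [diamondSum, Finset.mul_sum]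
    refine Finset.sum_congr rfl fun a _ => Finset.sum_congr rfl fun d _ =>
      Finset.sum_congr rfl fun b _ => Finset.sum_congr rfl fun c _ => ?_
    field_simp
  have h4 : (0 : ℝ) ≤ (n : ℝ) ^ 4 := by positivity
  rw [h3] at h1
  nlinarith [mul_le_mul_of_nonneg_left h2 h4]

/-! ### Monotonicity, the limit and the upper bound -/

/-- An injective sequence in a linear order is order-isomorphic to a permutation. -/
theorem exists_perm_lt_iff {n : ℕ} {β : Type*} [LinearOrder β] {f : Fin n → β}
    (hf : Function.Injective f) : ∃ P : Equiv.Perm (Fin n), ∀ i j, P i < P j ↔ f i < f j := by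
  have hmono : StrictMono (f ∘ Tuple.sort f) :=
    (Tuple.monotone_sort f).strictMono_of_injective (hf.comp (Tuple.sort f).injective)
  refine ⟨(Tuple.sort f)⁻¹, fun i j => ?_⟩
  have := hmono.lt_iff_lt (a := (Tuple.sort f)⁻¹ i) (b := (Tuple.sort f)⁻¹ j)
  simpa using this.symm

theorem density_le_maxDensity {m n : ℕ} (S : Equiv.Perm (Fin m)) (P : Equiv.Perm (Fin n)) :
    density S P ≤ maxDensity S n :=
  Finset.le_sup' (fun P : Equiv.Perm (Fin n) => density S P) (Finset.mem_univ P)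

/-- Averaging over the deletion of a point. -/
theorem density_succ_le_maxDensity {m n : ℕ} (hmn : m ≤ n) (S : Equiv.Perm (Fin m))
    (Q : Equiv.Perm (Fin (n + 1))) : density S Q ≤ maxDensity S n := by
  classical
  have hdel : ∀ i : Fin (n + 1), ∃ P : Equiv.Perm (Fin n), ∀ j k,
      P j < P k ↔ Q (i.succAbove j) < Q (i.succAbove k) := fun i =>
    exists_perm_lt_iff (f := fun j => Q (i.succAbove j))
      (Q.injective.comp Fin.succAbove_right_injective)
  choose P hP using hdel
  set O : Finset (Fin m ↪o Fin (n + 1)) :=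
    Finset.univ.filter fun e => ∀ i j : Fin m, S i < S j ↔ Q (e i) < Q (e j) with hO
  have hOcard : occurrences S Q = O.card := by
    rw [occurrences, Nat.card_eq_fintype_card, Fintype.card_subtype]
  have hle : ∀ i, (O.filter fun e => ∀ j, e j ≠ i).card ≤ occurrences S (P i) := by
    intro i
    rw [occurrences, Nat.card_eq_fintype_card, Fintype.card_subtype]
    refine Finset.card_le_card_of_surjOn (fun e => e.trans (Fin.succAboveOrderEmb i)) ?_
    intro e he
    simp only [hO, Finset.coe_filter, Finset.mem_filter, Finset.mem_univ, true_and,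
      Set.mem_ofPred_eq] at he
    choose g hg using fun j => Fin.exists_succAbove_eq (he.2 j)
    have hgm : StrictMono g := fun j k hjk => by
      rw [← i.strictMono_succAbove.lt_iff_lt, hg, hg]
      exact e.strictMono hjk
    refine ⟨OrderEmbedding.ofStrictMono g hgm, ?_, ?_⟩
    · simp only [Finset.coe_filter, Finset.mem_univ, true_and, Set.mem_ofPred_eq]
      intro j k
      rw [hP]
      simpa [hg] using he.1 j k
    · ext j
      simp [hg]
  -- Double counting: each occurrence survives the deletion of any of the n + 1 - m points it does
  -- not use.
  have hcount : ∑ i, (O.filter fun e => ∀ j, e j ≠ i).card = O.card * (n + 1 - m) := by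
    simp only [Finset.card_filter]
    rw [Finset.sum_comm, Finset.sum_const_nat]
    intro e _
    rw [← Finset.card_filter]
    have : (Finset.univ.filter fun i => ∀ j, e j ≠ i) = (Finset.univ.image e)ᶜ := by
      ext i
      simp
    rw [this, Finset.card_compl, Finset.card_image_of_injective _ e.injective]
    simp
  have hchoose : (n + 1).choose m * (n + 1 - m) = (n + 1) * n.choose m := by
    rw [← Nat.choose_mul_succ_eq, mul_comm]
  have hpos : (0 : ℝ) < n.choose m := by exact_mod_cast Nat.choose_pos hmn
  have hpos' : (0 : ℝ) < (n + 1).choose m := by exact_mod_cast Nat.choose_pos (by omega)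
  have h1 : ((O.card * (n + 1 - m) : ℕ) : ℝ) ≤ (n + 1) * (maxDensity S n * n.choose m) := by
    rw [← hcount]
    push_cast
    calc ∑ i, ((O.filter fun e => ∀ j, e j ≠ i).card : ℝ)
        ≤ ∑ _i : Fin (n + 1), maxDensity S n * n.choose m := by
          refine Finset.sum_le_sum fun i _ => ?_
          have := density_le_maxDensity S (P i)
          rw [density, div_le_iff₀ hpos] at this
          exact le_trans (by exact_mod_cast hle i) this
      _ = (n + 1) * (maxDensity S n * n.choose m) := by simp
  have h2 : (((n + 1).choose m : ℝ)) * ((n + 1 - m : ℕ) : ℝ) = (n + 1) * n.choose m := by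
    exact_mod_cast hchoose
  have h3 : (0 : ℝ) < ((n + 1 - m : ℕ) : ℝ) := by
    exact_mod_cast Nat.sub_pos_of_lt (Nat.lt_succ_of_le hmn)
  rw [density, div_le_iff₀ hpos', hOcard]
  push_cast at h1
  refine le_of_mul_le_mul_right ?_ h3
  rw [mul_assoc, h2]
  linarith

theorem maxDensity_nonneg {m : ℕ} (S : Equiv.Perm (Fin m)) (n : ℕ) : 0 ≤ maxDensity S n :=
  le_trans (by unfold density; positivity) (density_le_maxDensity S 1)

/-- The shift by m skips the lengths below m, where the density is 0 by convention. -/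
theorem antitone_maxDensity_add {m : ℕ} (S : Equiv.Perm (Fin m)) :
    Antitone fun n => maxDensity S (n + m) := by
  refine antitone_nat_of_succ_le fun n => ?_
  rw [add_right_comm]
  exact Finset.sup'_le _ _ fun Q _ => density_succ_le_maxDensity (Nat.le_add_left m n) S Q

/-- The maximum densities of a permutation converge to its packing density. -/
theorem tendsto_maxDensity {m : ℕ} (S : Equiv.Perm (Fin m)) :
    Filter.Tendsto (fun n : ℕ => maxDensity S n) Filter.atTop (nhds (packingDensity S)) := by
  have h := tendsto_atTop_ciInf (antitone_maxDensity_add S)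
    ⟨0, by rintro _ ⟨n, rfl⟩; exact maxDensity_nonneg S _⟩
  rw [Filter.tendsto_add_atTop_iff_nat (f := fun n => maxDensity S n)] at h
  rwa [packingDensity, h.limUnder_eq]

theorem packingDensity_le_maxDensity {m n : ℕ} (S : Equiv.Perm (Fin m)) (hmn : m ≤ n) :
    packingDensity S ≤ maxDensity S n := by
  obtain ⟨k, rfl⟩ := Nat.exists_eq_add_of_le' hmn
  exact (antitone_maxDensity_add S).le_of_tendsto
    ((Filter.tendsto_add_atTop_iff_nat m).2 (tendsto_maxDensity S)) k

/-- An upper bound for the packing density of 1324. -/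
theorem packingDensity_perm1324_le : packingDensity perm1324 ≤ 0.24405453999 := by
  -- At length k + 3 the binomial coefficient is at least k⁴/24, so the loss is the factor ((k +
  -- 3)/k)⁴.
  have hlim : Filter.Tendsto (fun k : ℕ => 0.24405453999 * (1 + 3 / (k : ℝ)) ^ 4) Filter.atTop
      (nhds (0.24405453999 * (1 + 0) ^ 4)) :=
    (((tendsto_const_div_atTop_nhds_zero_nat (3 : ℝ)).const_add 1).pow 4).const_mul _
  rw [add_zero, one_pow, mul_one] at hlim
  refine ge_of_tendsto hlim ?_
  filter_upwards [Filter.eventually_gt_atTop 0] with k hk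
  refine (packingDensity_le_maxDensity perm1324 (n := k + 3) (by omega)).trans ?_
  refine Finset.sup'_le _ _ fun P _ => ?_
  have hk' : (0 : ℝ) < k := by exact_mod_cast hk
  have h1 := occurrences_le (n := k + 3) (by omega) P
  have h2 := Nat.pow_le_choose (α := ℝ) 4 (k + 3)
  have h3 : ((k + 3 + 1 - 4 : ℕ) : ℝ) = k := by congr 1
  have h4 : ((Nat.factorial 4 : ℕ) : ℝ) = 24 := by norm_num [Nat.factorial]
  rw [h3, h4] at h2
  have h5 : 0.24405453999 * (1 + 3 / (k : ℝ)) ^ 4 * ((k : ℝ) ^ 4 / 24) =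
      0.24405453999 * ((k + 3 : ℕ) : ℝ) ^ 4 / 24 := by
    push_cast
    field_simp
  have hpos : (0 : ℝ) < (k + 3).choose 4 := by
    exact_mod_cast Nat.choose_pos (by omega)
  rw [density, div_le_iff₀ hpos]
  have h6 : 0.24405453999 * (1 + 3 / (k : ℝ)) ^ 4 * ((k : ℝ) ^ 4 / 24) ≤
      0.24405453999 * (1 + 3 / (k : ℝ)) ^ 4 * (k + 3).choose 4 := by gcongr
  linarith

/-! ### Layered permutations and the lower bound -/

theorem occurs_perm1324_of_lt {n : ℕ} {P : Equiv.Perm (Fin n)} {a b c d : Fin n} (hab : a < b)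
    (hbc : b < c) (hcd : c < d) (h1 : P a < P c) (h2 : P c < P b) (h3 : P b < P d) :
    ∃ e : Fin 4 ↪o Fin n, (∀ i j : Fin 4, perm1324 i < perm1324 j ↔ P (e i) < P (e j)) ∧
      e 0 = a ∧ e 1 = b ∧ e 2 = c ∧ e 3 = d := by
  have he : StrictMono ![a, b, c, d] := by
    rw [Fin.strictMono_iff_lt_succ]
    intro i
    fin_cases i <;> simp [hab, hbc, hcd]
  have hv : StrictMono ![P a, P c, P b, P d] := by
    rw [Fin.strictMono_iff_lt_succ]
    intro i
    fin_cases i <;> simp [h1, h2, h3]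
  refine ⟨OrderEmbedding.ofStrictMono _ he, fun i j => ?_, rfl, rfl, rfl, rfl⟩
  have hcomp : ∀ i, ![P a, P c, P b, P d] (perm1324 i) = P (![a, b, c, d] i) := by
    intro i
    rw [perm1324_apply]
    fin_cases i <;> rfl
  rw [← hv.lt_iff_lt, hcomp, hcomp]
  rfl

/-- A layered permutation with prescribed layer lengths, given by the map from positions to
layers. -/
theorem exists_layered {k : ℕ} (s : Fin k → ℕ) :
    ∃ (c : Fin (∑ j, s j) → Fin k) (P : Equiv.Perm (Fin (∑ j, s j))), Monotone c ∧
      (∀ h : Fin k → ℕ, ∑ i, h (c i) = ∑ j, s j * h j) ∧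
      ∀ i j, P i < P j ↔ c i < c j ∨ c i = c j ∧ j < i := by
  let g : Fin (∑ j, s j) ≃o (Σₗ j : Fin k, Fin (s j)) :=
    Fintype.orderIsoFinOfCardEq (Σₗ j : Fin k, Fin (s j)) (by
      rw [← Fintype.card_congr (toLex (α := Σ j : Fin k, Fin (s j)))]
      simp)
  let c : Fin (∑ j, s j) → Fin k := fun i => (ofLex (g i)).1
  -- Values are ordered by layer first and by reversed position inside a layer, so layers are
  -- decreasing.
  obtain ⟨P, hP⟩ := exists_perm_lt_iff (f := fun i => toLex (c i, OrderDual.toDual i))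
    (fun i j h => by simpa using congrArg (fun x => (ofLex x).2) h)
  refine ⟨c, P, fun i j hij => ?_, fun h => ?_, fun i j => ?_⟩
  · have := g.monotone hij
    rw [Sigma.Lex.le_def] at this
    rcases this with h | ⟨h, -⟩
    · exact h.le
    · exact h.le
  · rw [← Equiv.sum_comp (g.toEquiv.trans ofLex).symm]
    simp [c, Fintype.sum_sigma]
  · rw [hP, Prod.Lex.toLex_lt_toLex]
    simp

/-- The number of occurrences of 1324 in a layered permutation. -/
theorem exists_le_two_mul_occurrences {k : ℕ} (s : Fin k → ℕ) :
    ∃ P : Equiv.Perm (Fin (∑ j, s j)),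
      ∑ j, s j * ((∑ i, s i * if i < j then 1 else 0) * (s j *
        (∑ i, s i * if j < i then 1 else 0))) ≤
      2 * occurrences perm1324 P + (∑ j, s j) ^ 3 := by
  classical
  obtain ⟨c, P, hc, hsum, hP⟩ := exists_layered s
  refine ⟨P, ?_⟩
  revert c P
  generalize ∑ j, s j = m
  intro c P hc hsum hP
  -- Quadruples (b, a, x, d) with b, x in one layer, a in a lower and d in a higher one. Those with
  -- b < x are occurrences, those with x < b mirror them, and b = x accounts for at most m³.
  set S : Finset (Fin m × Fin m × Fin m × Fin m) :=
    Finset.univ.filter fun q => c q.2.1 < c q.1 ∧ c q.1 = c q.2.2.1 ∧ c q.1 < c q.2.2.2 with hS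
  have hcard : S.card = ∑ j, s j * ((∑ i, s i * if i < j then 1 else 0) * (s j *
      (∑ i, s i * if j < i then 1 else 0))) := by
    rw [← hsum (fun j => (∑ i, s i * if i < j then 1 else 0) * (s j *
      (∑ i, s i * if j < i then 1 else 0))), hS, Finset.card_filter]
    simp only [Fintype.sum_prod_type]
    refine Finset.sum_congr rfl fun b _ => ?_
    rw [← hsum (fun i => if i < c b then 1 else 0), ← hsum (fun i => if c b < i then 1 else 0)]
    have : s (c b) = ∑ x, if c b = c x then 1 else 0 := by
      rw [hsum (fun j => if c b = j then 1 else 0)]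
      simp
    rw [this, Finset.sum_mul_sum, Finset.sum_mul]
    refine Finset.sum_congr rfl fun a _ => ?_
    rw [Finset.mul_sum]
    refine Finset.sum_congr rfl fun x _ => ?_
    rw [Finset.mul_sum]
    refine Finset.sum_congr rfl fun d _ => ?_
    split_ifs <;> first | rfl | (exfalso; tauto)
  rw [← hcard]
  have h1 : (S.filter fun q => q.1 < q.2.2.1).card ≤ occurrences perm1324 P := by
    have hex : ∀ q : S.filter (fun q => q.1 < q.2.2.1), ∃ e : Fin 4 ↪o Fin m,
        (∀ i j : Fin 4, perm1324 i < perm1324 j ↔ P (e i) < P (e j)) ∧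
        e 0 = q.1.2.1 ∧ e 1 = q.1.1 ∧ e 2 = q.1.2.2.1 ∧ e 3 = q.1.2.2.2 := by
      rintro ⟨⟨b, a, x, d⟩, hq⟩
      simp only [hS, Finset.mem_filter, Finset.mem_univ, true_and] at hq
      obtain ⟨⟨hab, hbx, hbd⟩, hlt⟩ := hq
      refine occurs_perm1324_of_lt (hc.reflect_lt hab) hlt (hc.reflect_lt (hbx ▸ hbd)) ?_ ?_ ?_
      · exact (hP _ _).2 (Or.inl (hbx ▸ hab))
      · exact (hP _ _).2 (Or.inr ⟨hbx.symm, hlt⟩)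
      · exact (hP _ _).2 (Or.inl hbd)
    choose e he h0 h1 h2 h3 using hex
    rw [← Fintype.card_coe, ← Nat.card_eq_fintype_card]
    refine Nat.card_le_card_of_injective (fun q => ⟨e q, he q⟩) fun q q' h => ?_
    have h' : e q = e q' := congrArg Subtype.val h
    refine Subtype.ext (Prod.ext ?_ (Prod.ext ?_ (Prod.ext ?_ ?_)))
    · rw [← h1, ← h1, h']
    · rw [← h0, ← h0, h']
    · rw [← h2, ← h2, h']
    · rw [← h3, ← h3, h']
  have h2 : (S.filter fun q => q.2.2.1 < q.1).card ≤ (S.filter fun q => q.1 < q.2.2.1).card := by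
    refine Finset.card_le_card_of_injOn (fun q => (q.2.2.1, q.2.1, q.1, q.2.2.2)) ?_ ?_
    · rintro ⟨b, a, x, d⟩ hq
      simp only [hS, Finset.coe_filter, Finset.mem_filter, Finset.mem_univ, true_and,
        Set.mem_ofPred_eq] at hq ⊢
      exact ⟨⟨hq.1.2.1 ▸ hq.1.1, hq.1.2.1.symm, hq.1.2.1 ▸ hq.1.2.2⟩, hq.2⟩
    · rintro ⟨b, a, x, d⟩ _ ⟨b', a', x', d'⟩ _ h
      simp only [Prod.mk.injEq] at h ⊢
      tauto
  have h3 : (S.filter fun q => q.1 = q.2.2.1).card ≤ m ^ 3 := by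
    have : (Finset.univ : Finset (Fin m × Fin m × Fin m)).card = m ^ 3 := by
      simp [Fintype.card_prod]
      ring
    rw [← this]
    refine Finset.card_le_card_of_injOn (fun q => (q.1, q.2.1, q.2.2.2)) (by simp) ?_
    rintro ⟨b, a, x, d⟩ hq ⟨b', a', x', d'⟩ hq' h
    simp only [Finset.coe_filter, Set.mem_ofPred_eq] at hq hq'
    simp only [Prod.mk.injEq] at h ⊢
    have e1 := hq.2
    have e2 := hq'.2
    refine ⟨h.1, h.2.1, ?_, h.2.2⟩
    rw [← e1, ← e2, h.1]
  have hunion : S ⊆ (S.filter fun q => q.1 < q.2.2.1) ∪ (S.filter fun q => q.2.2.1 < q.1) ∪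
      (S.filter fun q => q.1 = q.2.2.1) := by
    intro q hq
    simp only [Finset.mem_union, Finset.mem_filter, hq, true_and]
    rcases lt_trichotomy q.1 q.2.2.1 with h | h | h <;> simp [h]
  have h4 := (Finset.card_le_card hunion).trans ((Finset.card_union_le _ _).trans
    (Nat.add_le_add_right (Finset.card_union_le _ _) _))
  omega

/-- Layer lengths proportional to a near-optimal sequence of layers. -/
def layerLengths : Fin 13 → ℕ := ![8, 15, 39, 107, 290, 761, 1560, 761, 290, 107, 39, 15, 8]

theorem sum_layerLengths : ∑ j, layerLengths j = 4000 := by decide +kernel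

theorem layerLengths_value :
    ∑ j, layerLengths j * ((∑ i, layerLengths i * if i < j then 1 else 0) * (layerLengths j *
        (∑ i, layerLengths i * if j < i then 1 else 0))) = 5206494576704 := by
  decide +kernel

theorem maxDensity_mul_ge {N : ℕ} (hN : 0 < N) :
    12 * (5206494576704 - 4000 ^ 3 / (N : ℝ)) / 4000 ^ 4 ≤ maxDensity perm1324 (N * 4000) := by
  obtain ⟨P, hP⟩ := exists_le_two_mul_occurrences (fun j => N * layerLengths j)
  have hm : ∑ j, N * layerLengths j = N * 4000 := by
    rw [← Finset.mul_sum, sum_layerLengths]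
  have hV : ∑ j, N * layerLengths j * ((∑ i, N * layerLengths i * if i < j then 1 else 0) *
      (N * layerLengths j * (∑ i, N * layerLengths i * if j < i then 1 else 0))) =
      N ^ 4 * 5206494576704 := by
    rw [← layerLengths_value, Finset.mul_sum]
    refine Finset.sum_congr rfl fun j _ => ?_
    simp only [mul_assoc, ← Finset.mul_sum]
    ring
  rw [hV] at hP
  have hmax := density_le_maxDensity perm1324 P
  generalize hn : ∑ j, N * layerLengths j = n at *
  subst hm
  refine le_trans ?_ hmax
  have hN' : (0 : ℝ) < N := by exact_mod_cast hN
  have hpos : (0 : ℝ) < (N * 4000).choose 4 := by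
    exact_mod_cast Nat.choose_pos (by omega)
  have h1 := Nat.choose_le_pow_div (α := ℝ) 4 (N * 4000)
  have h4 : ((Nat.factorial 4 : ℕ) : ℝ) = 24 := by norm_num [Nat.factorial]
  rw [h4] at h1
  have hP' : (N : ℝ) ^ 4 * 5206494576704 ≤ 2 * occurrences perm1324 P + ((N : ℝ) * 4000) ^ 3 := by
    exact_mod_cast hP
  rw [density, le_div_iff₀ hpos]
  -- The upper bound on the binomial coefficient may only be multiplied by a nonnegative number;
  -- otherwise the claim is trivial.
  rcases le_total 0 (12 * (5206494576704 - 4000 ^ 3 / (N : ℝ)) / 4000 ^ 4) with h | h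
  · refine (mul_le_mul_of_nonneg_left h1 h).trans ?_
    have : 12 * (5206494576704 - 4000 ^ 3 / (N : ℝ)) / 4000 ^ 4 * (((N * 4000 : ℕ) : ℝ) ^ 4 / 24) =
        ((N : ℝ) ^ 4 * 5206494576704 - ((N : ℝ) * 4000) ^ 3) / 2 := by
      push_cast
      field_simp
      ring
    rw [this]
    linarith
  · exact (mul_nonpos_of_nonpos_of_nonneg h hpos.le).trans (Nat.cast_nonneg _)

/-- A lower bound for the packing density of 1324. -/
theorem le_packingDensity_perm1324 : 12 * 5206494576704 / 4000 ^ 4 ≤ packingDensity perm1324 := by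
  have h1 : Filter.Tendsto (fun N : ℕ => maxDensity perm1324 (N * 4000)) Filter.atTop
      (nhds (packingDensity perm1324)) :=
    (tendsto_maxDensity perm1324).comp (Filter.tendsto_id.atTop_mul_const' (by norm_num))
  have h2 : Filter.Tendsto (fun N : ℕ => 12 * (5206494576704 - 4000 ^ 3 / (N : ℝ)) / 4000 ^ 4)
      Filter.atTop (nhds (12 * (5206494576704 - 0) / 4000 ^ 4)) :=
    (((tendsto_const_div_atTop_nhds_zero_nat _).const_sub _).const_mul _).div_const _
  rw [sub_zero] at h2
  refine le_of_tendsto_of_tendsto h2 h1 ?_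
  filter_upwards [Filter.eventually_gt_atTop 0] with N hN
  exact maxDensity_mul_ge hN

end PatternPacking

/-- The maximum densities of 1324 converge, and their limit, the packing density of 1324, obeys
the stated bounds. -/
theorem theorem3p2 :
    Filter.Tendsto (fun n : ℕ => PatternPacking.maxDensity PatternPacking.perm1324 n)
      Filter.atTop (nhds (PatternPacking.packingDensity PatternPacking.perm1324)) ∧
    (0.244054321 : ℝ) < PatternPacking.packingDensity PatternPacking.perm1324 ∧
    PatternPacking.packingDensity PatternPacking.perm1324 < (0.244054549 : ℝ) ∧
    PatternPacking.packingDensity PatternPacking.perm1324 < (0.244054540 : ℝ) := by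
  refine ⟨PatternPacking.tendsto_maxDensity _, ?_, ?_, ?_⟩
  · exact lt_of_lt_of_le (by norm_num) PatternPacking.le_packingDensity_perm1324
  · exact lt_of_le_of_lt PatternPacking.packingDensity_perm1324_le (by norm_num)
  · exact lt_of_le_of_lt PatternPacking.packingDensity_perm1324_le (by norm_num)
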